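/- Work in the ring $\mathbb{C}[x^{\pm1},y^{\pm1}]$ of complex Laurent polynomials, writing $X^{u}=x^{u_1}y^{u_2}$ for $u\in\mathbb{Z}^2$. A Laurent polynomial $\varphi$ is a line polynomial in direction $v\in\mathbb{Z}^2\setminus\{0\}$ if its support contains at least two points and is contained in $u+\mathbb{Q}v$ for some $u\in\mathbb{Z}^2$; non-zero vectors $v,w\in\mathbb{Z}^2$ are parallel if $w\in\mathbb{Q}v$. For a finite set $D\subseteq\mathbb{Z}^2$ put $f_D=\sum_{u\in D}X^{-u}$. For non-negative integers $b,a$, a configuration $c\in\{0,1\}^{\mathbb{Z}^2}$ is a $(D,b,a)$-covering if for every $u\in\mathbb{Z}^2$ the number of $d\in D$ with $c_{u+d}=1$ is exactly $b$ when $c_u=1$ and exactly $a$ when $c_u=0$. Theorem. There is a single algorithm (a partial recursive function) which, given as input a finite set $D\subseteq\mathbb{Z}^2$ (as a list of its points) and non-negative integers $b$ and $a$ such that the Laurent polynomial $g=f_D-(b-a)$ has line polynomial factors in at most one direction up to parallelism (that is, if $\varphi$ and $\psi$ divide $g$ in $\mathbb{C}[x^{\pm1},y^{\pm1}]$ and are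 line polynomials in directions $v$ and $w$ respectively, then $v$ and $w$ are parallel; having no line polynomial factors is allowed), halts and correctly determines whether there exists any $(D,b,a)$-covering. -/

import Mathlib

/-- The points of `ℤ²`, viewed as vectors of `ℚ²`. -/
def toRat (u : ℤ × ℤ) : ℚ × ℚ := ((u.1 : ℚ), (u.2 : ℚ))

/-- Complex Laurent polynomials in two variables: finitely supported functions `ℤ² → ℂ`
with the convolution product; `AddMonoidAlgebra.single u z` is the monomial `z X^u`. -/
abbrev LaurentPoly : Type := AddMonoidAlgebra ℂ (ℤ × ℤ)

/-- The support of a Laurent polynomial, i.e. the set of exponents with nonzero coefficient. -/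
def laurentSupport (f : LaurentPoly) : Set (ℤ × ℤ) := {u | f.coeff u ≠ 0}

/-- Integer vectors `v`, `w` are parallel if both are nonzero and `w ∈ ℚ v`. -/
def Parallel (v w : ℤ × ℤ) : Prop :=
  v ≠ 0 ∧ w ≠ 0 ∧ ∃ q : ℚ, toRat w = q • toRat v

/-- `f` is a line polynomial in direction `v ≠ 0`: its support has at least two points and
is contained in `u + ℚ v` for some `u`. -/
def IsLinePolynomial (f : LaurentPoly) (v : ℤ × ℤ) : Prop :=
  v ≠ 0 ∧ (laurentSupport f).Nontrivial ∧
    ∃ u : ℤ × ℤ, ∀ w ∈ laurentSupport f, ∃ q : ℚ, toRat w = toRat u + q • toRat v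

/-- `f` has line polynomial factors in at most one direction, up to parallelism. -/
def LineFactorsInAtMostOneDirection (f : LaurentPoly) : Prop :=
  ∀ (φ ψ : LaurentPoly) (v w : ℤ × ℤ), φ ∣ f → ψ ∣ f →
    IsLinePolynomial φ v → IsLinePolynomial ψ w → Parallel v w

/-- The characteristic polynomial `f_D = ∑_{u ∈ D} X^{-u}` of a finite shape. -/
noncomputable def charPoly (D : Finset (ℤ × ℤ)) : LaurentPoly :=
  ∑ u ∈ D, AddMonoidAlgebra.single (-u) (1 : ℂ)

/-- The Laurent polynomial `g = f_D - (b - a)`. -/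
noncomputable def coveringPoly (D : Finset (ℤ × ℤ)) (b a : ℕ) : LaurentPoly :=
  charPoly D - AddMonoidAlgebra.single 0 ((b : ℂ) - (a : ℂ))

/-- `c ∈ {0,1}^{ℤ²}` is a `(D, b, a)`-covering: for every `u`, the pattern of `c` in `u + D`
contains exactly `b` ones if `c u = 1` and exactly `a` ones if `c u = 0`. -/
def IsCovering (D : Finset (ℤ × ℤ)) (b a : ℕ) (c : ℤ × ℤ → Fin 2) : Prop :=
  ∀ u : ℤ × ℤ,
    (c u = 1 → (D.filter (fun d => c (u + d) = 1)).card = b) ∧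
    (c u = 0 → (D.filter (fun d => c (u + d) = 1)).card = a)

/-- `question` is algorithmically decidable on the inputs satisfying `promise`: one partial
recursive function halts on every such input and outputs the correct answer.
Nothing is required of it on the other inputs. -/
def DecidableOn {α : Type} [Primcodable α] (promise question : α → Prop) : Prop :=
  ∃ f : α →. Bool, Partrec f ∧
    ∀ x, promise x → ∃ r ∈ f x, (r = true ↔ question x)

/-!
The problem is decided by a search for one of two things: a covering that is periodic in both
coordinates, or a finite region on which every colouring violates the covering condition. Both kinds
of certificate can be checked primitively recursively, each is sound, and by compactness a finite
obstruction exists whenever there is no covering. What needs the hypothesis on `g = f_D - (b - a)`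
is that a doubly periodic covering exists as soon as there is any covering `c`.

Let `w` be a primitive vector in the direction of the line polynomial factors of `g` (any primitive
vector if there are none). As `g c` is constant, `d = (X^w - 1) c` satisfies `g d = 0`, and `d`
takes values in `{-1, 0, 1}`. For a prime `p`, the Frobenius gives `g(X^p) ≡ g^p` modulo `p`, so the
integers `(g(X^p) d)(u)` are divisible by `p`; for large `p` they are smaller than `p`, hence zero.
Iterating, `g(X^n) d = 0` for all `n` in some progression `1 + k r`
(`exists_forall_sum_mul_smul_eq_zero`).

This forces a nonzero polynomial supported on the line `ℚ w` to annihilate `d`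
(`exists_mem_lineSubmonoid`). Otherwise the annihilator of `d` lies in a prime ideal `P` that
contains no such polynomial. In the fraction field of the quotient by `P` write `χ(u)` for the image
of `X^u`. The relations `∑ g_u χ(u) χ(r u)^k = 0` for all `k` give, by a Vandermonde argument, two
support points with `χ(r u) = χ(r u')`, so `χ(v) = 1` for a nonzero `v`, which is not parallel to
`w`. For the primitive vector `v₀` in the direction of `v`, `χ(v₀)` is therefore a root of unity `ζ
∈ ℂ`. Completing `v₀` to a basis `(v₀, e)` of `ℤ²` and substituting `X^{v₀} = ζ` in `g` leaves a
Laurent polynomial in `X^e`, nonzero because `X^{v₀} - ζ` is a line polynomial in a forbidden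
direction and does not divide `g`. So `χ(e)` is algebraic over `ℂ`, hence in `ℂ`; then `χ(w) = κ` is
in `ℂ` too, and `X^w - κ ∈ P` is supported on `ℚ w`, a contradiction.

Multiplying by `X^w - 1`, also `c` is annihilated by a polynomial supported on `ℚ w`, that is, `c`
satisfies a linear recurrence along each line in direction `w`. Having two values only, `c` is
periodic in that direction (`exists_period_of_mem_annihilator`), so it has finitely many rows, and a
pigeonhole argument on blocks of consecutive rows produces a doubly periodic covering
(`exists_doubly_periodic`).
-/

namespace GridCovering

/-! ### Ideals of Laurent polynomials and line polynomials -/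

section Algebra

open AddMonoidAlgebra Polynomial

variable {B : Type*} [CommRing B] [Algebra ℂ B]

lemma map_single_zsmul (φ : LaurentPoly →ₐ[ℂ] B) {v : ℤ × ℤ} {ζ : ℂ} (hζ : ζ ≠ 0)
    (h : φ (single v 1) = algebraMap ℂ B ζ) (n : ℤ) :
    φ (single (n • v) 1) = algebraMap ℂ B (ζ ^ n) := by
  have key : ((φ : LaurentPoly →* B).comp (AddMonoidAlgebra.of ℂ (ℤ × ℤ))).comp
        (AddMonoidHom.toMultiplicative (zmultiplesHom (ℤ × ℤ) v)) =
      ((algebraMap ℂ B : ℂ →* B).comp (Units.coeHom ℂ)).comp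
        (zpowersHom ℂˣ (Units.mk0 ζ hζ)) := by
    apply MonoidHom.ext_mint
    simpa using h
  simpa using DFunLike.congr_fun key (Multiplicative.ofAdd n)

lemma map_single_add (φ : LaurentPoly →ₐ[ℂ] B) (u v : ℤ × ℤ) :
    φ (single (u + v) 1) = φ (single u 1) * φ (single v 1) := by
  rw [← map_mul, single_mul_single, one_mul]

lemma map_single_nsmul (φ : LaurentPoly →ₐ[ℂ] B) (v : ℤ × ℤ) (n : ℕ) :
    φ (single (n • v) 1) = φ (single v 1) ^ n := by
  rw [← map_pow, single_pow, one_pow]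

lemma isUnit_map_single (φ : LaurentPoly →ₐ[ℂ] B) (v : ℤ × ℤ) : IsUnit (φ (single v 1)) := by
  refine IsUnit.of_mul_eq_one (φ (single (-v) 1)) ?_
  rw [← map_single_add, add_neg_cancel]
  exact map_one φ

lemma map_eq_sum (φ : LaurentPoly →ₐ[ℂ] B) (f : LaurentPoly) :
    φ f = ∑ u ∈ f.coeff.support, algebraMap ℂ B (f.coeff u) * φ (single u 1) := by
  conv_lhs => rw [← sum_coeff_single f]
  rw [Finsupp.sum, map_sum]
  refine Finset.sum_congr rfl fun u _ => ?_
  rw [← Algebra.smul_def, ← map_smul]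
  congr 1
  simp [smul_single]

/-- Substitution of the constant `ζ` for `X^v` in `X^{n e} g`, where `(v, e)` is a basis of `ℤ²` in
which `u` has coordinates `α u` and `β u`; the result is a polynomial in `X^e` when `n` is large. -/
noncomputable def specialize (g : LaurentPoly) (ζ : ℂ) (α β : ℤ × ℤ → ℤ) (n : ℕ) : ℂ[X] :=
  ∑ u ∈ g.coeff.support, C (g.coeff u * ζ ^ α u) * X ^ (β u + n).toNat

lemma aeval_specialize (φ : LaurentPoly →ₐ[ℂ] B) (g : LaurentPoly) {v e : ℤ × ℤ} {ζ : ℂ}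
    (hζ : ζ ≠ 0) (h : φ (single v 1) = algebraMap ℂ B ζ) {α β : ℤ × ℤ → ℤ}
    (hab : ∀ u, α u • v + β u • e = u) {n : ℕ} (hn : ∀ u ∈ g.coeff.support, 0 ≤ β u + n) :
    aeval (φ (single e 1)) (specialize g ζ α β n) = φ (single (n • e) 1) * φ g := by
  rw [map_eq_sum φ g, Finset.mul_sum, specialize, map_sum]
  refine Finset.sum_congr rfl fun u hu => ?_
  rw [map_mul, map_pow, aeval_X, aeval_C, ← map_single_nsmul, map_mul,
    ← map_single_zsmul φ hζ h, mul_left_comm, mul_assoc, ← map_single_add, ← map_single_add]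
  have h1 : ((β u + n).toNat : ℕ) • e = (β u + n) • e := by
    rw [← natCast_zsmul, Int.toNat_of_nonneg (hn u hu)]
  have h2 : α u • v + (β u + n).toNat • e = n • e + u := by
    nth_rewrite 3 [← hab u]
    rw [h1, add_smul, natCast_zsmul]
    abel
  rw [h2]

/-- If `X^v = ζ` forces the polynomial `specialize g` to vanish, then `X^v - ζ` divides `g`. -/
lemma dvd_of_specialize_eq_zero (g : LaurentPoly) {v e : ℤ × ℤ} {ζ : ℂ}
    (hζ : ζ ≠ 0) {α β : ℤ × ℤ → ℤ}
    (hab : ∀ u, α u • v + β u • e = u) {n : ℕ} (hn : ∀ u ∈ g.coeff.support, 0 ≤ β u + n)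
    (h0 : specialize g ζ α β n = 0) : (single v 1 - single 0 ζ : LaurentPoly) ∣ g := by
  set J : Ideal LaurentPoly := Ideal.span {single v 1 - single 0 ζ} with hJ
  let π : LaurentPoly →ₐ[ℂ] LaurentPoly ⧸ J := Ideal.Quotient.mkₐ ℂ J
  have hπ : π (single v 1) = algebraMap ℂ _ ζ := by
    have h1 : π (single v 1 - single 0 ζ) = 0 :=
      Ideal.Quotient.eq_zero_iff_mem.2 (Ideal.subset_span rfl)
    rw [map_sub, sub_eq_zero] at h1
    rw [h1, ← AlgHom.commutes π]
    rfl
  have h2 := aeval_specialize π g hζ hπ hab hn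
  rw [h0, map_zero, eq_comm, (isUnit_map_single π _).mul_right_eq_zero] at h2
  exact Ideal.mem_span_singleton.1 (Ideal.Quotient.eq_zero_iff_mem.1 h2)

lemma isLinePolynomial_single_sub {v : ℤ × ℤ} (hv : v ≠ 0) {ζ : ℂ} (hζ : ζ ≠ 0) :
    IsLinePolynomial (single v 1 - single 0 ζ) v := by
  refine ⟨hv, ⟨v, ?_, 0, ?_, hv⟩, 0, fun w hw => ?_⟩
  · simp [laurentSupport, hv.symm]
  · simp [laurentSupport, hv, hζ]
  · by_cases h1 : w = v
    · exact ⟨1, by simp [h1, toRat]⟩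
    by_cases h2 : w = 0
    · exact ⟨0, by simp [h2, toRat]⟩
    · refine absurd ?_ hw
      simp [Ne.symm h1, Ne.symm h2]

/-- Two vectors of `ℤ²` are linearly dependent. Unlike for `Parallel`, they may be zero. -/
def Collinear₂ (v w : ℤ × ℤ) : Prop := v.1 * w.2 = v.2 * w.1

lemma collinear_of_parallel {v w : ℤ × ℤ} (h : Parallel v w) : Collinear₂ v w := by
  obtain ⟨-, -, q, hq⟩ := h
  simp only [toRat, Prod.smul_mk, Prod.mk.injEq, smul_eq_mul] at hq
  have : (v.1 * w.2 : ℚ) = v.2 * w.1 := by rw [hq.1, hq.2]; ring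
  unfold Collinear₂
  exact_mod_cast this

/-- Every nonzero vector is a positive multiple of a vector that belongs to a basis of `ℤ²`. -/
lemma exists_basis {v : ℤ × ℤ} (hv : v ≠ 0) : ∃ (m : ℕ) (v₀ e : ℤ × ℤ), 0 < m ∧ v = m • v₀ ∧
    v₀.1 * e.2 - v₀.2 * e.1 = 1 := by
  have hg : 0 < Int.gcd v.1 v.2 := by
    rw [Int.gcd_pos_iff]
    by_contra! h
    exact hv (Prod.ext h.1 h.2)
  obtain ⟨p, q, hc, h1, h2⟩ := Int.exists_gcd_one hg
  have := Int.gcd_eq_gcd_ab p q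
  rw [hc] at this
  refine ⟨Int.gcd v.1 v.2, (p, q), (-Int.gcdB p q, Int.gcdA p q), hg, ?_, ?_⟩
  · ext
    · simpa [mul_comm] using h1
    · simpa [mul_comm] using h2
  · push_cast at this
    simp only; linarith

lemma coord_eq {v e : ℤ × ℤ} (h : v.1 * e.2 - v.2 * e.1 = 1) (u : ℤ × ℤ) :
    (u.1 * e.2 - u.2 * e.1) • v + (v.1 * u.2 - v.2 * u.1) • e = u := by
  ext
  · simp only [Prod.fst_add, Prod.smul_fst, smul_eq_mul]; linear_combination u.1 * h
  · simp only [Prod.snd_add, Prod.smul_snd, smul_eq_mul]; linear_combination u.2 * h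

lemma exists_scalar_of_isAlgebraic {K : Type*} [Field K] [Algebra ℂ K] {z : K}
    (h : IsAlgebraic ℂ z) : ∃ ζ : ℂ, z = algebraMap ℂ K ζ := by
  obtain ⟨ζ, hζ⟩ := minpoly.mem_range_of_degree_eq_one ℂ z
    (IsAlgClosed.degree_eq_one_of_irreducible ℂ (minpoly.irreducible h.isIntegral))
  exact ⟨ζ, hζ.symm⟩

/-- The Laurent polynomial `g(X^n)`. -/
noncomputable def dilate (n : ℕ) (g : LaurentPoly) : LaurentPoly :=
  ∑ u ∈ g.coeff.support, single (n • u) (g.coeff u)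

lemma map_dilate (φ : LaurentPoly →ₐ[ℂ] B) (n : ℕ) (g : LaurentPoly) :
    φ (dilate n g) =
      ∑ u ∈ g.coeff.support, algebraMap ℂ B (g.coeff u) * φ (single u 1) ^ n := by
  rw [dilate, map_sum]
  refine Finset.sum_congr rfl fun u _ => ?_
  rw [← map_single_nsmul, ← Algebra.smul_def, ← map_smul]
  congr 1
  simp [smul_single]

/-- A Vandermonde argument: a vanishing exponential sum has two equal bases. -/
lemma exists_eq_of_sum_mul_pow_eq_zero {K ι : Type*} [Field K] [DecidableEq ι] (s : Finset ι)
    (a z : ι → K) (h : ∀ k : ℕ, ∑ i ∈ s, a i * z i ^ k = 0) {i : ι} (hi : i ∈ s) (ha : a i ≠ 0) :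
    ∃ j ∈ s, j ≠ i ∧ z j = z i := by
  set p : K[X] := ∏ j ∈ s.erase i, (X - C (z j)) with hp
  have h1 : ∑ j ∈ s, a j * p.eval (z j) = 0 := by
    simp_rw [eval_eq_sum_range, Finset.mul_sum]
    rw [Finset.sum_comm]
    refine Finset.sum_eq_zero fun k _ => ?_
    rw [← mul_zero (p.coeff k), ← h k, Finset.mul_sum]
    exact Finset.sum_congr rfl fun j _ => by ring
  rw [Finset.sum_eq_single_of_mem i hi] at h1
  · have h2 := (mul_eq_zero.1 h1).resolve_left ha
    rw [hp, eval_prod, Finset.prod_eq_zero_iff] at h2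
    obtain ⟨j, hj, h3⟩ := h2
    rw [Finset.mem_erase] at hj
    refine ⟨j, hj.2, hj.1, ?_⟩
    simpa [sub_eq_zero, eq_comm] using h3
  · intro j hj hji
    have : p.eval (z j) = 0 := by
      rw [hp, eval_prod]
      exact Finset.prod_eq_zero (Finset.mem_erase.2 ⟨hji, hj⟩) (by simp)
    rw [this, mul_zero]

/-- Nonzero Laurent polynomials whose support lies on the line `ℚ w`. They are closed under products
because the Laurent polynomials form a domain. -/
noncomputable def lineSubmonoid (w : ℤ × ℤ) : Submonoid LaurentPoly where
  carrier := {f | f ≠ 0 ∧ ∀ u ∈ f.coeff.support, Collinear₂ u w}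
  one_mem' := by
    refine ⟨one_ne_zero, fun u hu => ?_⟩
    have : u = 0 := by
      by_contra h
      rw [one_def] at hu
      exact h (by simpa using hu)
    simp [this, Collinear₂]
  mul_mem' := by
    rintro f g ⟨hf, hf'⟩ ⟨hg, hg'⟩
    refine ⟨mul_ne_zero hf hg, fun u hu => ?_⟩
    classical
    obtain ⟨x, hx, y, hy, rfl⟩ := Finset.mem_add.1 (support_coeff_mul_subset f g hu)
    have h1 := hf' x hx
    have h2 := hg' y hy
    unfold Collinear₂ at *
    simp only [Prod.fst_add, Prod.snd_add]
    linear_combination h1 + h2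

lemma single_sub_mem_lineSubmonoid {v w : ℤ × ℤ} (hv : v ≠ 0) (h : Collinear₂ v w) (ζ : ℂ) :
    (single v 1 - single 0 ζ : LaurentPoly) ∈ lineSubmonoid w := by
  refine ⟨fun h0 => ?_, fun u hu => ?_⟩
  · have := congrArg (fun f : LaurentPoly => f.coeff v) h0
    simp [hv.symm] at this
  · by_cases h1 : u = v
    · rwa [h1]
    by_cases h2 : u = 0
    · simp [h2, Collinear₂]
    · simp [Ne.symm h1, Ne.symm h2] at hu

lemma exists_forall_nonneg_add {ι : Type*} (s : Finset ι) (β : ι → ℤ) :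
    ∃ n : ℕ, ∀ u ∈ s, 0 ≤ β u + n := by
  refine ⟨s.sup fun u => (β u).natAbs, fun u hu => ?_⟩
  have : (β u).natAbs ≤ s.sup fun u => (β u).natAbs := Finset.le_sup (f := fun u => (β u).natAbs) hu
  omega

/-- Evaluation form of the main algebraic fact: at a point over a field where all `g(X^{1+kr})`
vanish, some nonzero polynomial supported on `ℚ w` vanishes. -/
lemma exists_lineSubmonoid_map_eq_zero {K : Type*} [Field K] [Algebra ℂ K]
    (φ : LaurentPoly →ₐ[ℂ] K) {g : LaurentPoly} (hg : g ≠ 0) {w : ℤ × ℤ} (hw : w ≠ 0)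
    (hline : ∀ ψ v, ψ ∣ g → IsLinePolynomial ψ v → Collinear₂ v w) {r : ℕ} (hr : 0 < r)
    (h : ∀ k : ℕ, φ (dilate (1 + k * r) g) = 0) : ∃ f ∈ lineSubmonoid w, φ f = 0 := by
  classical
  have hsup : g.coeff.support.Nonempty := by
    rw [Finsupp.support_nonempty_iff]; simpa using hg
  obtain ⟨i, hi⟩ := hsup
  have hne : ∀ u, φ (single u 1) ≠ 0 := fun u => (isUnit_map_single φ u).ne_zero
  have hconst : ∀ ζ : ℂ, φ (single 0 ζ) = algebraMap ℂ K ζ := fun ζ => φ.commutes ζ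
  -- two support points whose difference, multiplied by `r`, is sent to `1`
  obtain ⟨j, -, hji, hz⟩ := exists_eq_of_sum_mul_pow_eq_zero g.coeff.support
    (fun u => algebraMap ℂ K (g.coeff u) * φ (single u 1)) (fun u => φ (single u 1) ^ r)
    (fun k => by
      rw [← h k, map_dilate]
      exact Finset.sum_congr rfl fun u _ => by ring) hi
    (mul_ne_zero (by simpa using hi) (hne i))
  set v : ℤ × ℤ := r • (j - i) with hv
  have hv0 : v ≠ 0 := smul_ne_zero hr.ne' (sub_ne_zero.2 hji)
  have hφv : φ (single v 1) = 1 := by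
    have h1 : φ (single (v + r • i) 1) = φ (single (r • i) 1) := by
      rw [hv, ← smul_add, sub_add_cancel, map_single_nsmul, map_single_nsmul, hz]
    rw [map_single_add] at h1
    exact mul_right_cancel₀ (hne _) (h1.trans (one_mul _).symm)
  by_cases hpar : Collinear₂ v w
  · exact ⟨_, single_sub_mem_lineSubmonoid hv0 hpar 1, by rw [map_sub, hφv, hconst]; simp⟩
  -- both members of a basis `(v₀, e)` of `ℤ²` with `v ∈ ℕ v₀` are sent to scalars
  obtain ⟨m, v₀, e, hm, hvm, hdet⟩ := exists_basis hv0
  have hv₀ : v₀ ≠ 0 := by rintro rfl; simp at hdet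
  obtain ⟨ζ, hζ⟩ : ∃ ζ : ℂ, φ (single v₀ 1) = algebraMap ℂ K ζ := by
    apply exists_scalar_of_isAlgebraic
    refine ⟨X ^ m - 1, X_pow_sub_C_ne_zero hm 1, ?_⟩
    rw [map_sub, map_pow, aeval_X, map_one, ← map_single_nsmul, ← hvm, hφv, sub_self]
  have hζ0 : ζ ≠ 0 := by rintro rfl; exact hne v₀ (by rw [hζ, map_zero])
  set α : ℤ × ℤ → ℤ := fun u => u.1 * e.2 - u.2 * e.1
  set β : ℤ × ℤ → ℤ := fun u => v₀.1 * u.2 - v₀.2 * u.1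
  have hab : ∀ u, α u • v₀ + β u • e = u := coord_eq hdet
  obtain ⟨n, hn⟩ := exists_forall_nonneg_add g.coeff.support β
  obtain ⟨η, hη⟩ : ∃ η : ℂ, φ (single e 1) = algebraMap ℂ K η := by
    apply exists_scalar_of_isAlgebraic
    refine ⟨specialize g ζ α β n, fun h0 => hpar ?_, ?_⟩
    · have h1 := hline _ v₀ (dvd_of_specialize_eq_zero g hζ0 hab hn h0)
        (isLinePolynomial_single_sub hv₀ hζ0)
      rw [hvm]
      unfold Collinear₂ at *
      simp only [Prod.smul_fst, Prod.smul_snd]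
      simp only [nsmul_eq_mul]
      linear_combination (m : ℤ) * h1
    · rw [aeval_specialize φ g hζ0 hζ hab hn]
      have h1 := h 0
      rw [map_dilate] at h1
      rw [map_eq_sum φ g]
      simpa using Or.inr h1
  have hη0 : η ≠ 0 := by rintro rfl; exact hne e (by rw [hη, map_zero])
  refine ⟨_, single_sub_mem_lineSubmonoid hw (by simp [Collinear₂, mul_comm])
    (ζ ^ α w * η ^ β w), ?_⟩
  rw [map_sub, hconst, sub_eq_zero, map_mul, ← map_single_zsmul φ hζ0 hζ,
    ← map_single_zsmul φ hη0 hη, ← map_single_add, hab]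

/-- An ideal that contains `g(X^{1+kr})` for all `k` meets `lineSubmonoid w`. -/
theorem exists_mem_lineSubmonoid (I : Ideal LaurentPoly) {g : LaurentPoly} (hg : g ≠ 0)
    {w : ℤ × ℤ} (hw : w ≠ 0)
    (hline : ∀ ψ v, ψ ∣ g → IsLinePolynomial ψ v → Collinear₂ v w) {r : ℕ} (hr : 0 < r)
    (h : ∀ k : ℕ, dilate (1 + k * r) g ∈ I) : ∃ f ∈ lineSubmonoid w, f ∈ I := by
  by_contra! hcon
  obtain ⟨P, hP, hIP, hdisj⟩ := Ideal.exists_le_prime_disjoint I (lineSubmonoid w)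
    (Set.disjoint_left.2 fun f hf hf' => hcon f hf' hf)
  let φ : LaurentPoly →ₐ[ℂ] FractionRing (LaurentPoly ⧸ P) :=
    (IsScalarTower.toAlgHom ℂ (LaurentPoly ⧸ P) _).comp (Ideal.Quotient.mkₐ ℂ P)
  have hφ : ∀ f, φ f = 0 ↔ f ∈ P := fun f => by
    rw [← Ideal.Quotient.eq_zero_iff_mem]
    exact (map_eq_zero_iff _ (IsFractionRing.injective (LaurentPoly ⧸ P) _))
  obtain ⟨f, hf, hf0⟩ := exists_lineSubmonoid_map_eq_zero φ hg hw hline hr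
    fun k => (hφ _).2 (hIP (h k))
  exact Set.disjoint_left.1 hdisj ((hφ f).1 hf0) hf

end Algebra

/-! ### The action of Laurent polynomials on configurations -/

section Action

open AddMonoidAlgebra

variable {A : Type*} [CommRing A]

/-- Translation of configurations: `(X^v c)(u) = c (u - v)`. -/
def shiftHom (A : Type*) [CommRing A] :
    Multiplicative (ℤ × ℤ) →* Module.End A (ℤ × ℤ → A) where
  toFun v := LinearMap.funLeft A A fun u => u - v.toAdd
  map_one' := by ext; simp [LinearMap.funLeft]
  map_mul' v w := by
    refine LinearMap.ext fun c => funext fun u => ?_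
    simp [LinearMap.funLeft, sub_sub]

/-- The action of Laurent polynomials over `A` on configurations `ℤ² → A` by formal product. -/
noncomputable def act (A : Type*) [CommRing A] :
    AddMonoidAlgebra A (ℤ × ℤ) →ₐ[A] Module.End A (ℤ × ℤ → A) :=
  AddMonoidAlgebra.lift A _ _ (shiftHom A)

lemma act_single (v : ℤ × ℤ) (x : A) (c : ℤ × ℤ → A) (u : ℤ × ℤ) :
    act A (single v x) c u = x * c (u - v) := by
  simp [act, shiftHom, LinearMap.funLeft, AddMonoidAlgebra.lift_single]

lemma act_sum_single {ι : Type*} (s : Finset ι) (e : ι → ℤ × ℤ) (a : ι → A) (c : ℤ × ℤ → A)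
    (u : ℤ × ℤ) : act A (∑ i ∈ s, single (e i) (a i)) c u = ∑ i ∈ s, a i * c (u - e i) := by
  rw [map_sum, LinearMap.sum_apply, Finset.sum_apply]
  exact Finset.sum_congr rfl fun i _ => act_single _ _ _ _

lemma act_apply (f : AddMonoidAlgebra A (ℤ × ℤ)) (c : ℤ × ℤ → A) (u : ℤ × ℤ) :
    act A f c u = ∑ v ∈ f.coeff.support, f.coeff v * c (u - v) := by
  rw [← act_sum_single]
  conv_lhs => rw [← sum_coeff_single f]
  rfl

/-- The ideal of Laurent polynomials that annihilate a configuration. -/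
noncomputable def annihilator (c : ℤ × ℤ → A) : Ideal (AddMonoidAlgebra A (ℤ × ℤ)) where
  carrier := {f | act A f c = 0}
  zero_mem' := by simp
  add_mem' {f g} hf hg := by
    simp only [Set.mem_ofPred_eq] at *
    rw [map_add, LinearMap.add_apply, hf, hg, add_zero]
  smul_mem' f g hg := by
    simp only [Set.mem_ofPred_eq, smul_eq_mul] at *
    rw [map_mul, Module.End.mul_apply, hg, map_zero]

lemma mem_annihilator {f : AddMonoidAlgebra A (ℤ × ℤ)} {c : ℤ × ℤ → A} :
    f ∈ annihilator c ↔ act A f c = 0 := Iff.rfl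

end Action

/-! ### Dilation of annihilating polynomials -/

section Dilation

open AddMonoidAlgebra

variable {ι : Type*} (s : Finset ι) (a : ι → ℤ) {d : ℤ × ℤ → ℤ}

/-- In characteristic `p` the Frobenius gives `f(X^p) = f^p`, so that `f(X^p) d` is divisible by `p`;
being smaller than `p`, it vanishes. -/
lemma sum_mul_prime_smul_eq_zero (hd : ∀ u, |d u| ≤ 1) {p : ℕ} (hp : p.Prime)
    (hap : ∑ i ∈ s, |a i| < p) (e : ι → ℤ × ℤ) (h : ∀ u, ∑ i ∈ s, a i * d (u - e i) = 0)
    (u : ℤ × ℤ) : ∑ i ∈ s, a i * d (u - p • e i) = 0 := by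
  have := Fact.mk hp
  have hmem : (∑ i ∈ s, single (e i) (a i : ZMod p)) ∈ annihilator fun u => (d u : ZMod p) := by
    refine mem_annihilator.2 (funext fun u => ?_)
    rw [act_sum_single]
    exact_mod_cast congrArg (Int.cast : ℤ → ZMod p) (h u)
  have hpow : (∑ i ∈ s, single (e i) (a i : ZMod p)) ^ p =
      ∑ i ∈ s, single (p • e i) (a i : ZMod p) := by
    have : CharP (AddMonoidAlgebra (ZMod p) (ℤ × ℤ)) p :=
      charP_of_injective_algebraMap' (ZMod p) p
    rw [sum_pow_char]
    exact Finset.sum_congr rfl fun i _ => by rw [single_pow, ZMod.pow_card]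
  have h1 := congrFun (mem_annihilator.1 (Ideal.pow_mem_of_mem _ hmem p hp.pos)) u
  rw [hpow, act_sum_single] at h1
  refine Int.eq_zero_of_abs_lt_dvd (m := (p : ℤ)) ?_ ?_
  · rw [← ZMod.intCast_zmod_eq_zero_iff_dvd]
    push_cast
    exact h1
  · refine lt_of_le_of_lt (Finset.abs_sum_le_sum_abs _ _) (lt_of_le_of_lt ?_ hap)
    refine Finset.sum_le_sum fun i _ => ?_
    rw [abs_mul]
    exact mul_le_of_le_one_right (abs_nonneg _) (hd _)

lemma sum_mul_smul_eq_zero (hd : ∀ u, |d u| ≤ 1) (n : ℕ) (hn : n ≠ 0)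
    (hprime : ∀ p : ℕ, p.Prime → p ∣ n → ∑ i ∈ s, |a i| < p) (e : ι → ℤ × ℤ)
    (h : ∀ u, ∑ i ∈ s, a i * d (u - e i) = 0) (u : ℤ × ℤ) :
    ∑ i ∈ s, a i * d (u - n • e i) = 0 := by
  induction n using induction_on_primes generalizing e u with
  | zero => exact absurd rfl hn
  | one => simpa using h u
  | prime_mul p m hp ih =>
    have h1 := ih (right_ne_zero_of_mul hn) (fun q hq hqm => hprime q hq (hqm.mul_left p)) e h
    have h2 := sum_mul_prime_smul_eq_zero s a hd hp (hprime p hp (dvd_mul_right p m)) _ h1 u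
    simpa only [mul_smul] using h2

/-- `f d = 0` implies `f(X^n) d = 0` for all `n` in an arithmetic progression `1 + k r`: for `r = B!`
the prime factors of such `n` all exceed the bound `B`. -/
lemma exists_forall_sum_mul_smul_eq_zero (hd : ∀ u, |d u| ≤ 1) (e : ι → ℤ × ℤ)
    (h : ∀ u, ∑ i ∈ s, a i * d (u - e i) = 0) :
    ∃ r : ℕ, 0 < r ∧ ∀ k u, ∑ i ∈ s, a i * d (u - (1 + k * r) • e i) = 0 := by
  refine ⟨(∑ i ∈ s, |a i|).toNat.factorial, Nat.factorial_pos _, fun k u =>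
    sum_mul_smul_eq_zero s a hd _ (by omega) (fun p hp hpn => ?_) e h u⟩
  by_contra! hle
  have h1 : p ∣ k * (∑ i ∈ s, |a i|).toNat.factorial :=
    (Nat.dvd_factorial hp.pos (by omega)).mul_left k
  exact hp.one_lt.ne' (Nat.dvd_one.1 ((Nat.dvd_add_iff_left h1).2 hpn))

end Dilation

/-! ### Linear recurrences along lines -/

section LinePeriod

open AddMonoidAlgebra

/-- If finitely many states evolve reversibly and deterministically along translation by `w`, then
the evolution is periodic, with a period that does not depend on the starting point. -/
lemma exists_period_of_finite_states {G Y : Type*} [AddCommGroup G] [Finite Y] (w : G) (y : G → Y)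
    (h : ∀ u u', y u = y u' ↔ y (u + w) = y (u' + w)) :
    ∃ N : ℕ, 0 < N ∧ ∀ u, y (u + N • w) = y u := by
  have hiter : ∀ (n : ℕ) (u u' : G), y u = y u' ↔ y (u + n • w) = y (u' + n • w) := by
    intro n
    induction n with
    | zero => simp
    | succ n ih =>
      intro u u'
      rw [ih, h, succ_nsmul, add_assoc, add_assoc]
  refine ⟨(Nat.card Y).factorial, Nat.factorial_pos _, fun u => ?_⟩
  obtain ⟨i, j, hij, hy⟩ : ∃ i j : Fin (Nat.card Y + 1), i < j ∧
      y (u + (i : ℕ) • w) = y (u + (j : ℕ) • w) := by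
    by_contra! hcon
    have hinj : Function.Injective fun i : Fin (Nat.card Y + 1) => y (u + (i : ℕ) • w) := by
      intro i j hij
      rcases lt_trichotomy i j with hlt | rfl | hlt
      · exact absurd hij (hcon i j hlt)
      · rfl
      · exact absurd hij.symm (hcon j i hlt)
    have := Nat.card_le_card_of_injective _ hinj
    simp at this
  obtain ⟨p, hp⟩ := Nat.exists_eq_add_of_lt (Fin.lt_def.1 hij)
  have h1 : y u = y (u + (p + 1) • w) := by
    rw [hiter (i : ℕ), hy, hp]
    congr 1
    module
  have h2 : ∀ k : ℕ, y (u + (k * (p + 1)) • w) = y u := by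
    intro k
    induction k with
    | zero => simp
    | succ k ih =>
      rw [← ih, add_one_mul, add_smul, add_comm ((k * (p + 1)) • w), ← add_assoc]
      exact ((hiter _ _ _).1 h1).symm
  obtain ⟨q, hq⟩ : p + 1 ∣ (Nat.card Y).factorial :=
    Nat.dvd_factorial (Nat.succ_pos p) (by omega)
  rw [hq, mul_comm]
  exact h2 q

/-- The values of a binary configuration as complex numbers. -/
def toComplex (c : ℤ × ℤ → Fin 2) (u : ℤ × ℤ) : ℂ := ((c u : ℕ) : ℂ)

/-- A binary configuration annihilated by a polynomial supported on the line of a primitive vector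
`w` satisfies a linear recurrence along `w`, and is therefore periodic in that direction. -/
lemma exists_period_of_mem_annihilator {w e : ℤ × ℤ} (hdet : w.1 * e.2 - w.2 * e.1 = 1)
    {f : LaurentPoly} (hf : f ∈ lineSubmonoid w) {c : ℤ × ℤ → Fin 2}
    (hc : f ∈ annihilator (toComplex c)) : ∃ N : ℕ, 0 < N ∧ ∀ u, c (u + N • w) = c u := by
  obtain ⟨hf0, hcol⟩ := hf
  set α : ℤ × ℤ → ℤ := fun u => u.1 * e.2 - u.2 * e.1 with hα
  have hαw : ∀ v ∈ f.coeff.support, v = α v • w := by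
    intro v hv
    have h1 := coord_eq hdet v
    have h2 : w.1 * v.2 - w.2 * v.1 = 0 := by
      have := hcol v hv
      unfold Collinear₂ at this
      linear_combination -this
    rw [h2, zero_smul, add_zero] at h1
    exact h1.symm
  -- equality of all terms of the recurrence but one gives equality of the last one
  have hdetm : ∀ u u' : ℤ × ℤ, ∀ v₀ ∈ f.coeff.support,
      (∀ v ∈ f.coeff.support, α v ≠ α v₀ → c (u - α v • w) = c (u' - α v • w)) →
      c (u - α v₀ • w) = c (u' - α v₀ • w) := by
    intro u u' v₀ hv₀ heq
    have h1 := congrFun hc u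
    have h2 := congrFun hc u'
    rw [act_apply, ← Finset.add_sum_erase _ _ hv₀] at h1 h2
    have h3 : ∑ v ∈ f.coeff.support.erase v₀, f.coeff v * toComplex c (u - v) =
        ∑ v ∈ f.coeff.support.erase v₀, f.coeff v * toComplex c (u' - v) := by
      refine Finset.sum_congr rfl fun v hv => ?_
      rw [Finset.mem_erase] at hv
      have := heq v hv.2 fun hv' => hv.1 (by rw [hαw v hv.2, hαw v₀ hv₀, hv'])
      rw [← hαw v hv.2] at this
      rw [toComplex, toComplex, this]
    rw [h3] at h1
    have h1 := add_right_cancel (h1.trans h2.symm)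
    have h4 := mul_left_cancel₀ (Finsupp.mem_support_iff.1 hv₀) h1
    rw [← hαw v₀ hv₀]
    exact Fin.ext (Nat.cast_injective (R := ℂ) h4)
  have hne : f.coeff.support.Nonempty := by
    rw [Finsupp.support_nonempty_iff]; simpa using hf0
  obtain ⟨v₁, hv₁, hmin⟩ := Finset.exists_min_image _ α hne
  obtain ⟨v₂, hv₂, hmax⟩ := Finset.exists_max_image _ α hne
  obtain ⟨m, hm⟩ := Int.eq_ofNat_of_zero_le (sub_nonneg.2 (hmin v₂ hv₂))
  -- the state at `u` is the word of length `m + 1` that starts at `u` in direction `w`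
  let y : ℤ × ℤ → Fin (m + 1) → Fin 2 := fun u i => c (u + ((i : ℕ) : ℤ) • w)
  have hy : ∀ u u' (k : ℤ), y u = y u' → 0 ≤ k → k ≤ m → c (u + k • w) = c (u' + k • w) := by
    intro u u' k h h0 hk
    have := congrFun h ⟨k.toNat, by omega⟩
    simp only [y] at this
    rwa [Int.toNat_of_nonneg h0] at this
  obtain ⟨N, hN, hper⟩ := exists_period_of_finite_states w y fun u u' => by
    constructor
    · intro h
      funext i
      have hcase : ((i : ℕ) : ℤ) + 1 ≤ m ∨ ((i : ℕ) : ℤ) = m := by omega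
      have hshift : ∀ x : ℤ × ℤ, x + w + ((i : ℕ) : ℤ) • w = x + (((i : ℕ) : ℤ) + 1) • w := by
        intro x; module
      simp only [y]
      rw [hshift, hshift]
      rcases hcase with hi | hi
      · exact hy u u' _ h (by omega) hi
      · have h1 := hdetm (u + (m + 1 + α v₁) • w) (u' + (m + 1 + α v₁) • w) v₁ hv₁
          fun v hv hvne => by
            have e1 : ∀ x : ℤ × ℤ, x + (m + 1 + α v₁) • w - α v • w =
              x + (m + 1 + α v₁ - α v) • w := fun x => by module
            rw [e1, e1]
            have := hmin v hv
            have := hmax v hv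
            exact hy u u' _ h (by omega) (by omega)
        have e1 : ∀ x : ℤ × ℤ, x + (m + 1 + α v₁) • w - α v₁ • w = x + ((m : ℤ) + 1) • w :=
          fun x => by module
        rw [e1, e1] at h1
        rw [hi]; exact h1
    · intro h
      funext i
      have hcase : 0 ≤ ((i : ℕ) : ℤ) - 1 ∨ ((i : ℕ) : ℤ) = 0 := by omega
      have hshift : ∀ x : ℤ × ℤ, x + ((i : ℕ) : ℤ) • w = x + w + (((i : ℕ) : ℤ) - 1) • w := by
        intro x; module
      simp only [y]
      rw [hshift, hshift]
      rcases hcase with hi | hi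
      · exact hy _ _ _ h hi (by omega)
      · have h1 := hdetm (u + w + (α v₂ - 1) • w) (u' + w + (α v₂ - 1) • w) v₂ hv₂
          fun v hv hvne => by
            have e1 : ∀ x : ℤ × ℤ, x + w + (α v₂ - 1) • w - α v • w =
              x + w + (α v₂ - 1 - α v) • w := fun x => by module
            rw [e1, e1]
            have := hmin v hv
            have := hmax v hv
            exact hy _ _ _ h (by omega) (by omega)
        have e1 : ∀ x : ℤ × ℤ, x + w + (α v₂ - 1) • w - α v₂ • w = x + w + ((0 : ℤ) - 1) • w :=
          fun x => by module
        rw [e1, e1] at h1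
        rw [hi]; exact h1
  refine ⟨N, hN, fun u => ?_⟩
  simpa [y] using congrFun (hper u) 0

end LinePeriod

/-! ### Periodicity of coverings -/

section CoveringPeriod

open AddMonoidAlgebra

lemma coeff_charPoly (D : Finset (ℤ × ℤ)) (v : ℤ × ℤ) :
    (charPoly D).coeff v = if -v ∈ D then 1 else 0 := by
  classical
  rw [charPoly, coeff_sum, Finsupp.finsetSum_apply]
  simp only [coeff_single, Finsupp.single_apply, neg_eq_iff_eq_neg]
  rw [Finset.sum_ite_eq']

lemma exists_int_coeff_coveringPoly (D : Finset (ℤ × ℤ)) (b a : ℕ) :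
    ∃ z : ℤ × ℤ → ℤ, ∀ v, (coveringPoly D b a).coeff v = z v := by
  classical
  refine ⟨fun v => (if -v ∈ D then 1 else 0) - if v = 0 then (b : ℤ) - a else 0, fun v => ?_⟩
  rw [coveringPoly, coeff_sub, Finsupp.sub_apply, coeff_charPoly]
  by_cases h : v = 0 <;> simp [h]

/-- A covering satisfies `g c = a`, a constant configuration. -/
lemma act_coveringPoly {D : Finset (ℤ × ℤ)} {b a : ℕ} {c : ℤ × ℤ → Fin 2}
    (hc : IsCovering D b a c) (u : ℤ × ℤ) :
    act ℂ (coveringPoly D b a) (toComplex c) u = a := by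
  have h1 : act ℂ (charPoly D) (toComplex c) u = (D.filter fun d => c (u + d) = 1).card := by
    rw [charPoly, act_sum_single, Finset.card_filter]
    push_cast
    refine Finset.sum_congr rfl fun d _ => ?_
    rw [one_mul, sub_neg_eq_add, toComplex]
    generalize c (u + d) = x
    fin_cases x <;> simp
  rw [coveringPoly, map_sub, LinearMap.sub_apply, Pi.sub_apply, h1, act_single, sub_zero]
  obtain ⟨hb, ha⟩ := hc u
  rw [toComplex]
  have h01 : c u = 0 ∨ c u = 1 := by
    rcases eq_or_ne (c u) 0 with h | h
    · exact .inl h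
    · exact .inr (Fin.eq_one_of_ne_zero _ h)
  rcases h01 with h | h
  · rw [ha h, h]; simp
  · rw [hb h, h]; simp

lemma coveringPoly_ne_zero_of_lineFactors {g : LaurentPoly}
    (h : LineFactorsInAtMostOneDirection g) : g ≠ 0 := by
  rintro rfl
  have h1 : ((1, 0) : ℤ × ℤ) ≠ 0 := by decide
  have h2 : ((0, 1) : ℤ × ℤ) ≠ 0 := by decide
  have := collinear_of_parallel (h _ _ _ _ (dvd_zero _) (dvd_zero _)
    (isLinePolynomial_single_sub h1 one_ne_zero) (isLinePolynomial_single_sub h2 one_ne_zero))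
  simp [Collinear₂] at this

/-- The line polynomial factors all have the direction of one primitive vector `w`. -/
lemma exists_direction {g : LaurentPoly} (h : LineFactorsInAtMostOneDirection g) :
    ∃ w e : ℤ × ℤ, w.1 * e.2 - w.2 * e.1 = 1 ∧
      ∀ ψ v, ψ ∣ g → IsLinePolynomial ψ v → Collinear₂ v w := by
  by_cases hex : ∃ φ v, φ ∣ g ∧ IsLinePolynomial φ v
  · obtain ⟨φ, v, hφ, hv⟩ := hex
    obtain ⟨m, w, e, hm, rfl, hdet⟩ := exists_basis hv.1
    refine ⟨w, e, hdet, fun ψ v' hψ hv' => ?_⟩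
    have h1 := collinear_of_parallel (h ψ φ v' _ hψ hφ hv' hv)
    have hm' : (m : ℤ) ≠ 0 := by exact_mod_cast hm.ne'
    unfold Collinear₂ at *
    refine mul_left_cancel₀ hm' ?_
    simp only [Prod.smul_fst, Prod.smul_snd] at h1
    simp only [nsmul_eq_mul] at h1
    linear_combination h1
  · push Not at hex
    exact ⟨(1, 0), (0, 1), by simp, fun ψ v hψ hv => absurd hv (hex ψ v hψ)⟩

/-- Every covering is periodic in the direction of the line polynomial factors. -/
theorem exists_period_of_isCovering {D : Finset (ℤ × ℤ)} {b a : ℕ} {c : ℤ × ℤ → Fin 2}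
    (hc : IsCovering D b a c) (hg : LineFactorsInAtMostOneDirection (coveringPoly D b a)) :
    ∃ w e : ℤ × ℤ, w.1 * e.2 - w.2 * e.1 = 1 ∧
      ∃ N : ℕ, 0 < N ∧ ∀ u, c (u + N • w) = c u := by
  obtain ⟨w, e, hdet, hline⟩ := exists_direction hg
  refine ⟨w, e, hdet, ?_⟩
  have hw : w ≠ 0 := by rintro rfl; simp at hdet
  obtain ⟨z, hz⟩ := exists_int_coeff_coveringPoly D b a
  -- `d = (X^w - 1) c` has values in `{-1, 0, 1}` and satisfies `g d = 0`
  let d : ℤ × ℤ → ℤ := fun u => (c (u - w) : ℕ) - (c u : ℕ)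
  set q : LaurentPoly := single w 1 - single 0 1 with hq
  have hd : (fun u => (d u : ℂ)) = act ℂ q (toComplex c) := by
    funext u
    rw [hq, map_sub, LinearMap.sub_apply, Pi.sub_apply, act_single, act_single]
    simp [d, toComplex]
  have hd1 : ∀ u, |d u| ≤ 1 := by
    intro u
    have h1 := (c (u - w)).isLt
    have h2 := (c u).isLt
    simp only [d]
    rw [abs_le]; omega
  have hgd : ∀ u, ∑ v ∈ (coveringPoly D b a).coeff.support, z v * d (u - v) = 0 := by
    intro u
    have h1 : act ℂ (coveringPoly D b a) (fun u => (d u : ℂ)) u = 0 := by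
      rw [hd, ← Module.End.mul_apply, ← map_mul, mul_comm, map_mul, Module.End.mul_apply, hq,
        map_sub, LinearMap.sub_apply, Pi.sub_apply, act_single, act_single, act_coveringPoly hc,
        act_coveringPoly hc, sub_self]
    rw [act_apply] at h1
    simp only [hz] at h1
    exact_mod_cast h1
  obtain ⟨r, hr, hdil⟩ := exists_forall_sum_mul_smul_eq_zero _ z hd1 id hgd
  obtain ⟨f, hf, hfd⟩ := exists_mem_lineSubmonoid (annihilator fun u => (d u : ℂ))
    (coveringPoly_ne_zero_of_lineFactors hg) hw hline hr fun k => by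
      refine mem_annihilator.2 (funext fun u => ?_)
      rw [dilate, act_sum_single]
      have h1 := congrArg (Int.cast : ℤ → ℂ) (hdil k u)
      simpa [hz] using h1
  refine exists_period_of_mem_annihilator hdet
    (mul_mem hf (single_sub_mem_lineSubmonoid hw (by simp [Collinear₂, mul_comm]) 1)) ?_
  rw [mem_annihilator, map_mul, Module.End.mul_apply, ← hq, ← hd]
  exact hfd

end CoveringPeriod

/-! ### The covering condition at one point -/

section Local

/-- The covering condition at a single point. -/
def IsCoveringAt (D : Finset (ℤ × ℤ)) (b a : ℕ) (c : ℤ × ℤ → Fin 2) (u : ℤ × ℤ) : Prop :=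
  (c u = 1 → (D.filter (fun d => c (u + d) = 1)).card = b) ∧
    (c u = 0 → (D.filter (fun d => c (u + d) = 1)).card = a)

variable {D : Finset (ℤ × ℤ)} {b a : ℕ} {c c' : ℤ × ℤ → Fin 2}

lemma isCovering_iff : IsCovering D b a c ↔ ∀ u, IsCoveringAt D b a c u := Iff.rfl

lemma IsCoveringAt.congr {u u' : ℤ × ℤ} (h : IsCoveringAt D b a c u) (h0 : c u = c' u')
    (hD : ∀ d ∈ D, c (u + d) = c' (u' + d)) : IsCoveringAt D b a c' u' := by
  have h1 : D.filter (fun d => c (u + d) = 1) = D.filter (fun d => c' (u' + d) = 1) :=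
    Finset.filter_congr fun d hd => by rw [hD d hd]
  unfold IsCoveringAt at *
  rwa [← h0, ← h1]

end Local

/-! ### Doubly periodic coverings -/

section Periodic

/-- A bi-infinite sequence over a finite type can be made periodic by a change of indices `h` that
keeps its factors of radius `L` among those of the sequence. -/
lemma exists_periodic_reindexing {Y : Type*} [Finite Y] (r : ℤ → Y) (L : ℕ) :
    ∃ (p : ℕ) (h h' : ℤ → ℤ), 0 < p ∧ (∀ x k : ℤ, h (x + k * p) = h x) ∧
      ∀ x k : ℤ, |k| ≤ L → r (h (x + k)) = r (h' x + k) := by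
  obtain ⟨n₁, n₂, hlt, hW⟩ : ∃ n₁ n₂ : ℕ, n₁ < n₂ ∧
      (fun i : Fin (2 * L + 1) => r (n₁ + (i : ℕ))) = fun i : Fin (2 * L + 1) => r (n₂ + (i : ℕ)) := by
    obtain ⟨x, y, hxy, hW⟩ := Finite.exists_ne_map_eq_of_infinite
      fun (n : ℕ) (i : Fin (2 * L + 1)) => r (n + (i : ℕ))
    rcases lt_or_gt_of_ne hxy with h | h
    · exact ⟨x, y, h, hW⟩
    · exact ⟨y, x, h, hW.symm⟩
  obtain ⟨p, hp0, rfl⟩ : ∃ p : ℕ, 0 < p ∧ n₂ = n₁ + p := ⟨n₂ - n₁, by omega, by omega⟩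
  -- the block of length `p + 2 L + 1` that starts at `n₁` has period `p`
  have key : ∀ j : ℕ, j ≤ p + 2 * L → r (n₁ + j) = r (n₁ + (j % p : ℕ)) := by
    intro j
    induction j using Nat.strong_induction_on with
    | _ j ih =>
      intro hj
      rcases lt_or_ge j p with hjp | hjp
      · rw [Nat.mod_eq_of_lt hjp]
      · obtain ⟨i, rfl⟩ := Nat.exists_eq_add_of_le hjp
        have h1 := congrFun hW ⟨i, by omega⟩
        simp only at h1
        rw [Nat.add_mod_left, ← ih i (by omega) (by omega), h1]
        push_cast
        rw [add_assoc]
  have hp : (p : ℤ) ≠ 0 := by omega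
  refine ⟨p, fun x => n₁ + (x - n₁) % p, fun x => n₁ + L + (x - n₁ - L) % p, hp0, fun x k => ?_,
    fun x k hk => ?_⟩
  · simp only
    rw [add_sub_right_comm, Int.add_mul_emod_self_right]
  · have h0 := Int.emod_nonneg (x - n₁ - L) hp
    have h1 := Int.emod_lt_of_pos (x - n₁ - L) (b := p) (by omega)
    rw [abs_le] at hk
    obtain ⟨j, hj⟩ := Int.eq_ofNat_of_zero_le
      (show 0 ≤ L + (x - n₁ - L) % p + k by omega)
    have h2 := key j (by omega)
    have h3 : ((j % p : ℕ) : ℤ) = (x + k - n₁) % p := by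
      push_cast
      rw [← hj, show (L : ℤ) + (x - n₁ - L) % p + k = (L + k) + (x - n₁ - L) % p by ring,
        Int.add_emod_emod]
      congr 1; ring
    simp only
    rw [← h3, ← h2, ← hj]
    congr 1; ring

/-- From a covering with one period, a covering that is periodic in both coordinates. -/
theorem exists_doubly_periodic {D : Finset (ℤ × ℤ)} {b a : ℕ} {c : ℤ × ℤ → Fin 2}
    (hc : IsCovering D b a c) {w e : ℤ × ℤ} (hdet : w.1 * e.2 - w.2 * e.1 = 1) {N : ℕ}
    (hN : 0 < N) (hper : ∀ u, c (u + N • w) = c u) :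
    ∃ (K : ℕ) (c' : ℤ × ℤ → Fin 2), 0 < K ∧ IsCovering D b a c' ∧
      ∀ (u : ℤ × ℤ) (x y : ℤ), c' (u + (x * K, y * K)) = c' u := by
  set α : ℤ × ℤ → ℤ := fun u => u.1 * e.2 - u.2 * e.1 with hα
  set β : ℤ × ℤ → ℤ := fun u => w.1 * u.2 - w.2 * u.1 with hβ
  have hab : ∀ u, α u • w + β u • e = u := coord_eq hdet
  have hαadd : ∀ u v, α (u + v) = α u + α v := fun u v => by
    simp only [hα, Prod.fst_add, Prod.snd_add]; ring
  have hβadd : ∀ u v, β (u + v) = β u + β v := fun u v => by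
    simp only [hβ, Prod.fst_add, Prod.snd_add]; ring
  have hperZ : ∀ u (k : ℤ), c (u + (k * N) • w) = c u := by
    intro u k
    have hp : Function.Periodic c (N • w) := hper
    have := hp.int_mul k u
    rw [← this]
    congr 2
    ext <;> simp [mul_assoc]
  have hN' : (N : ℤ) ≠ 0 := by omega
  -- the row at height `x`, as an element of a finite type
  let row : ℤ → Fin N → Fin 2 := fun x i => c (((i : ℕ) : ℤ) • w + x • e)
  have hrow : ∀ x x', row x = row x' → ∀ k : ℤ, c (k • w + x • e) = c (k • w + x' • e) := by
    intro x x' h k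
    have h0 := Int.emod_nonneg k hN'
    have h1 := Int.emod_lt_of_pos k (b := N) (by omega)
    have h2 := congrFun h ⟨(k % N).toNat, by omega⟩
    simp only [row, Int.toNat_of_nonneg h0] at h2
    have h3 : ∀ z : ℤ, k • w + z • e = (k % N) • w + z • e + (k / N * N) • w := by
      intro z
      nth_rewrite 1 [← Int.emod_add_ediv_mul k N]
      module
    rw [h3, h3, hperZ, hperZ, h2]
  obtain ⟨p, h, h', hp, hh, hh'⟩ := exists_periodic_reindexing row (D.sup fun d => (β d).natAbs)
  refine ⟨N * p, fun u => c (α u • w + h (β u) • e), Nat.mul_pos hN hp, isCovering_iff.2 fun u => ?_,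
    fun u x y => ?_⟩
  · refine (isCovering_iff.1 hc (α u • w + h' (β u) • e)).congr ?_ fun d hd => ?_
    · have := hh' (β u) 0 (by simp)
      rw [add_zero, add_zero] at this
      exact (hrow _ _ this _).symm
    · have hle : (β d).natAbs ≤ D.sup fun d => (β d).natAbs :=
        Finset.le_sup (f := fun d => (β d).natAbs) hd
      have := hh' (β u) (β d) (by rw [Int.abs_eq_natAbs]; exact_mod_cast hle)
      simp only [hαadd, hβadd]
      rw [hrow _ _ this]
      congr 1
      nth_rewrite 1 [← hab d]
      module
  · simp only [hαadd, hβadd]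
    have h1 : α (x * (N * p : ℕ), y * (N * p : ℕ)) = (x * e.2 - y * e.1) * p * N := by
      simp only [hα]; push_cast; ring
    have h2 : β (x * (N * p : ℕ), y * (N * p : ℕ)) = (w.1 * y - w.2 * x) * N * p := by
      simp only [hβ]; push_cast; ring
    rw [h1, h2, hh, add_smul, add_right_comm, hperZ]

end Periodic

/-! ### Primitive recursive functions on integers and lists -/

section IntPrimrec

open Encodable Primrec

lemma encode_natCast_int (n : ℕ) : encode (n : ℤ) = 2 * n := rfl
lemma encode_negSucc_int (n : ℕ) : encode (Int.negSucc n) = 2 * n + 1 := rfl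

lemma primrec_toNat : Primrec Int.toNat := by
  have h : Primrec fun u : ℤ => if encode u % 2 = 0 then encode u / 2 else 0 :=
    Primrec.ite (Primrec.eq.comp (nat_mod.comp Primrec.encode (Primrec.const 2)) (Primrec.const 0))
      (nat_div.comp Primrec.encode (Primrec.const 2)) (Primrec.const 0)
  refine h.of_eq fun u => ?_
  cases u with
  | ofNat n => simp [encode_natCast_int]
  | negSucc n => rw [encode_negSucc_int, if_neg (by omega)]; rfl

lemma primrec_toNat_neg : Primrec fun u : ℤ => (-u).toNat := by
  have h : Primrec fun u : ℤ => if encode u % 2 = 0 then 0 else encode u / 2 + 1 :=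
    Primrec.ite (Primrec.eq.comp (nat_mod.comp Primrec.encode (Primrec.const 2)) (Primrec.const 0))
      (Primrec.const 0) (Primrec.succ.comp (nat_div.comp Primrec.encode (Primrec.const 2)))
  refine h.of_eq fun u => ?_
  cases u with
  | ofNat n => simp [encode_natCast_int]
  | negSucc n => rw [encode_negSucc_int, if_neg (by omega)]; simp; omega

/-- The code of `n : ℕ` is `2 n` and that of `-(n + 1)` is `2 n + 1`. -/
lemma primrec_natCast_sub : Primrec₂ fun m n : ℕ => (m : ℤ) - n := by
  rw [← Primrec₂.encode_iff]
  have h : Primrec₂ fun m n : ℕ => if n ≤ m then 2 * (m - n) else 2 * (n - m - 1) + 1 :=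
    Primrec.ite (nat_le.comp Primrec.snd Primrec.fst)
      (nat_mul.comp (Primrec.const 2) (nat_sub.comp Primrec.fst Primrec.snd))
      (Primrec.succ.comp (nat_mul.comp (Primrec.const 2)
        (nat_sub.comp (nat_sub.comp Primrec.snd Primrec.fst) (Primrec.const 1))))
  refine h.of_eq fun m n => ?_
  split_ifs with hmn
  · rw [← encode_natCast_int, Nat.cast_sub hmn]
  · rw [← encode_negSucc_int]
    congr 1
    omega

lemma primrec_int_add : Primrec₂ fun u v : ℤ => u + v := by
  have h : Primrec₂ fun u v : ℤ =>
      ((u.toNat + v.toNat : ℕ) : ℤ) - (((-u).toNat + (-v).toNat : ℕ) : ℤ) :=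
    primrec_natCast_sub.comp
      (nat_add.comp (primrec_toNat.comp Primrec.fst) (primrec_toNat.comp Primrec.snd))
      (nat_add.comp (primrec_toNat_neg.comp Primrec.fst) (primrec_toNat_neg.comp Primrec.snd))
  exact h.of_eq fun u v => by omega

lemma primrec_natCast_int : Primrec fun n : ℕ => (n : ℤ) :=
  (primrec_natCast_sub.comp Primrec.id (Primrec.const 0)).of_eq fun n => by simp

/-- Since `-1 ≡ K - 1` modulo `K`, the residue of `u` is one of natural numbers. For `K = 0` the
convention is `u % 0 = u`. -/
lemma primrec_int_emod : Primrec₂ fun (u : ℤ) (K : ℕ) => u % (K : ℤ) := by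
  have h : Primrec₂ fun (u : ℤ) (K : ℕ) =>
      if K = 0 then u else (((u.toNat + (K - 1) * (-u).toNat) % K : ℕ) : ℤ) :=
    Primrec.ite (Primrec.eq.comp Primrec.snd (Primrec.const 0)) Primrec.fst
      (primrec_natCast_int.comp (nat_mod.comp
        (nat_add.comp (primrec_toNat.comp Primrec.fst)
          (nat_mul.comp (nat_sub.comp Primrec.snd (Primrec.const 1))
            (primrec_toNat_neg.comp Primrec.fst))) Primrec.snd))
  refine h.of_eq fun u K => ?_
  split_ifs with hK
  · simp [hK]
  · have h1 : u = u.toNat - (-u).toNat := by omega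
    conv_rhs => rw [h1]
    rw [Int.natCast_mod]
    push_cast [Nat.one_le_iff_ne_zero.2 hK]
    rw [show ((u.toNat : ℤ) + (K - 1) * (-u).toNat) = u.toNat - (-u).toNat + (-u).toNat * K by ring,
      Int.add_mul_emod_self_right]

lemma primrec_nat_pow : Primrec₂ fun m n : ℕ => m ^ n :=
  Primrec₂.unpaired'.1 Nat.Primrec.pow

lemma primrec_testBit : Primrec₂ Nat.testBit := by
  have h : PrimrecRel fun t i : ℕ => t / 2 ^ i % 2 = 1 :=
    Primrec.eq.comp (nat_mod.comp (nat_div.comp Primrec.fst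
      (primrec_nat_pow.comp (Primrec.const 2) Primrec.snd)) (Primrec.const 2)) (Primrec.const 1)
  exact h.decide.of_eq fun t i => Nat.testBit_eq_decide_div_mod_eq.symm

lemma primrec_dedup {α : Type*} [Primcodable α] [DecidableEq α] :
    Primrec (List.dedup : List α → List α) := by
  have hmem : PrimrecRel fun (l : List α) (x : α) => x ∈ l :=
    (PrimrecRel.exists_mem_list (Primrec.eq (α := α))).of_eq fun l x => by simp
  have h : Primrec fun l : List α =>
      l.foldr (fun x s => if x ∈ s then s else x :: s) [] :=
    Primrec.list_foldr (h := fun _ q => if q.1 ∈ q.2 then q.2 else q.1 :: q.2) Primrec.id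
      (Primrec.const []) (Primrec.ite
        (hmem.comp (Primrec.snd.comp Primrec.snd) (Primrec.fst.comp Primrec.snd))
        (Primrec.snd.comp Primrec.snd)
        (Primrec.list_cons.comp (Primrec.fst.comp Primrec.snd) (Primrec.snd.comp Primrec.snd)))
  refine h.of_eq fun l => ?_
  induction l with
  | nil => simp
  | cons x l ih =>
    rw [List.foldr_cons, ih]
    by_cases hx : x ∈ l
    · rw [if_pos (List.mem_dedup.2 hx), List.dedup_cons_of_mem hx]
    · rw [if_neg (mt List.mem_dedup.1 hx), List.dedup_cons_of_notMem hx]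

end IntPrimrec

/-! ### Configurations coded by natural numbers -/

section Coloring

open Encodable Primrec

/-- The configuration coded by the natural number `t`: the value at `u` is the binary digit of `t`
whose position is the code of `u mod K`. For `K = 0` nothing is reduced, as `z % 0 = z` in `ℤ`, and
the configuration has finitely many ones; for `K > 0` it is periodic. -/
def coloring (K t : ℕ) (u : ℤ × ℤ) : Fin 2 :=
  if t.testBit (encode (u.1 % (K : ℤ), u.2 % (K : ℤ))) then 1 else 0

lemma coloring_congr {K : ℕ} (t : ℕ) {u v : ℤ × ℤ} (h1 : u.1 % (K : ℤ) = v.1 % (K : ℤ))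
    (h2 : u.2 % (K : ℤ) = v.2 % (K : ℤ)) : coloring K t u = coloring K t v := by
  rw [coloring, h1, h2, coloring]

/-- Instances of the covering problem: the list of the points of `D`, and `b`, `a`. -/
abbrev Input : Type := List (ℤ × ℤ) × ℕ × ℕ

lemma primrec_add_point : Primrec₂ fun u v : ℤ × ℤ => u + v := by
  have h : Primrec₂ fun u v : ℤ × ℤ => (u.1 + v.1, u.2 + v.2) :=
    Primrec.pair
      (primrec_int_add.comp (Primrec.fst.comp Primrec.fst) (Primrec.fst.comp Primrec.snd))
      (primrec_int_add.comp (Primrec.snd.comp Primrec.fst) (Primrec.snd.comp Primrec.snd))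
  exact h

lemma primrec_coloring : Primrec fun q : (ℕ × ℕ) × ℤ × ℤ => coloring q.1.1 q.1.2 q.2 := by
  have hbit : Primrec fun q : (ℕ × ℕ) × ℤ × ℤ =>
      q.1.2.testBit (encode (q.2.1 % (q.1.1 : ℤ), q.2.2 % (q.1.1 : ℤ))) :=
    primrec_testBit.comp (Primrec.snd.comp Primrec.fst) (Primrec.encode.comp (Primrec.pair
      (primrec_int_emod.comp (Primrec.fst.comp Primrec.snd) (Primrec.fst.comp Primrec.fst))
      (primrec_int_emod.comp (Primrec.snd.comp Primrec.snd) (Primrec.fst.comp Primrec.fst))))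
  exact Primrec.ite (Primrec.eq.comp hbit (Primrec.const true)) (Primrec.const 1) (Primrec.const 0)

lemma primrecPred_isCoveringAt : PrimrecPred fun q : Input × (ℕ × ℕ) × ℤ × ℤ =>
    IsCoveringAt q.1.1.toFinset q.1.2.1 q.1.2.2 (coloring q.2.1.1 q.2.1.2) q.2.2 := by
  have hrel : PrimrecRel fun (d : ℤ × ℤ) (q : Input × (ℕ × ℕ) × ℤ × ℤ) =>
      coloring q.2.1.1 q.2.1.2 (q.2.2 + d) = 1 :=
    Primrec.eq.comp (primrec_coloring.comp (Primrec.pair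
      (Primrec.fst.comp (Primrec.snd.comp Primrec.snd))
      (primrec_add_point.comp (Primrec.snd.comp (Primrec.snd.comp Primrec.snd)) Primrec.fst)))
      (Primrec.const 1)
  have hcount : Primrec fun q : Input × (ℕ × ℕ) × ℤ × ℤ =>
      (q.1.1.dedup.filter fun d => coloring q.2.1.1 q.2.1.2 (q.2.2 + d) = 1).length :=
    Primrec.list_length.comp (hrel.listFilter.comp
      (primrec_dedup.comp (Primrec.fst.comp Primrec.fst)) Primrec.id)
  have hval : Primrec fun q : Input × (ℕ × ℕ) × ℤ × ℤ => coloring q.2.1.1 q.2.1.2 q.2.2 :=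
    primrec_coloring.comp Primrec.snd
  have hb : PrimrecPred fun q : Input × (ℕ × ℕ) × ℤ × ℤ =>
      ¬ coloring q.2.1.1 q.2.1.2 q.2.2 = 1 ∨
        (q.1.1.dedup.filter fun d => coloring q.2.1.1 q.2.1.2 (q.2.2 + d) = 1).length = q.1.2.1 :=
    (Primrec.eq.comp hval (Primrec.const 1)).not.or
      (Primrec.eq.comp hcount (Primrec.fst.comp (Primrec.snd.comp Primrec.fst)))
  have ha : PrimrecPred fun q : Input × (ℕ × ℕ) × ℤ × ℤ =>
      ¬ coloring q.2.1.1 q.2.1.2 q.2.2 = 0 ∨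
        (q.1.1.dedup.filter fun d => coloring q.2.1.1 q.2.1.2 (q.2.2 + d) = 1).length = q.1.2.2 :=
    (Primrec.eq.comp hval (Primrec.const 0)).not.or
      (Primrec.eq.comp hcount (Primrec.snd.comp (Primrec.snd.comp Primrec.fst)))
  refine (hb.and ha).of_eq fun q => ?_
  have hcard : (q.1.1.toFinset.filter fun d => coloring q.2.1.1 q.2.1.2 (q.2.2 + d) = 1).card =
      (q.1.1.dedup.filter fun d => coloring q.2.1.1 q.2.1.2 (q.2.2 + d) = 1).length := by
    rw [Finset.card_def, Finset.filter_val, List.toFinset_val, Multiset.filter_coe,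
      Multiset.coe_card]
  rw [IsCoveringAt, hcard, ← imp_iff_not_or, ← imp_iff_not_or]

end Coloring

/-! ### Certificates and the search for them -/

section Search

open Encodable Primrec

/-- A search for `n` with `R x n` or `S x n` decides a question whenever it terminates, provided
that `R` certifies positive and `S` negative answers. -/
theorem decidableOn_of_certificates {α : Type} [Primcodable α] {promise question : α → Prop}
    {R S : α → ℕ → Prop} (hR : PrimrecRel R) (hS : PrimrecRel S)
    (hyes : ∀ x n, R x n → question x) (hno : ∀ x n, S x n → ¬ question x)
    (hterm : ∀ x, promise x → ∃ n, R x n ∨ S x n) : DecidableOn promise question := by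
  classical
  have hRS : Primrec₂ fun x n => decide (R x n ∨ S x n) :=
    PrimrecRel.decide (PrimrecPred.or hR hS)
  have hfind : Partrec fun x => Nat.rfind fun n => Part.some (decide (R x n ∨ S x n)) :=
    Partrec.rfind hRS.to_comp.partrec₂
  refine ⟨_, hfind.map (g := fun x n => decide (R x n)) hR.decide.to_comp, fun x hx => ?_⟩
  have hdom : (Nat.rfind fun n => Part.some (decide (R x n ∨ S x n))).Dom := by
    obtain ⟨n, hn⟩ := hterm x hx
    exact Nat.rfind_dom.2 ⟨n, by simpa using hn, fun _ => trivial⟩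
  obtain ⟨n, hn⟩ := Part.dom_iff_mem.1 hdom
  refine ⟨decide (R x n), Part.mem_map _ hn, ?_⟩
  have hspec : R x n ∨ S x n := by simpa using Nat.rfind_spec hn
  rw [decide_eq_true_iff]
  exact ⟨hyes x n, fun hq => hspec.resolve_right fun hs => hno x n hs hq⟩

/-- `n` codes a period `K` and a number `t` whose `K`-periodic configuration is a covering. -/
def PeriodicCertificate (x : Input) (n : ℕ) : Prop :=
  0 < n.unpair.1 ∧ ∀ i ∈ List.range n.unpair.1, ∀ j ∈ List.range n.unpair.1,
    IsCoveringAt x.1.toFinset x.2.1 x.2.2 (coloring n.unpair.1 n.unpair.2) ((i : ℤ), (j : ℤ))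

/-- Every configuration on the cells with code less than `n` violates the covering condition at a
cell whose neighbourhood consists of such cells. -/
def ObstructionCertificate (x : Input) (n : ℕ) : Prop :=
  ∀ t ∈ List.range (2 ^ n), ∃ i ∈ List.range n,
    (∀ d ∈ x.1, encode (Denumerable.ofNat (ℤ × ℤ) i + d) < n) ∧
      ¬ IsCoveringAt x.1.toFinset x.2.1 x.2.2 (coloring 0 t) (Denumerable.ofNat (ℤ × ℤ) i)

lemma primrecRel_periodicCertificate : PrimrecRel PeriodicCertificate := by
  have hK : Primrec fun q : Input × ℕ => q.2.unpair.1 :=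
    Primrec.fst.comp (Primrec.unpair.comp Primrec.snd)
  have hcore : PrimrecRel fun (j : ℕ) (q : ℕ × Input × ℕ) =>
      IsCoveringAt q.2.1.1.toFinset q.2.1.2.1 q.2.1.2.2
        (coloring q.2.2.unpair.1 q.2.2.unpair.2) ((q.1 : ℤ), (j : ℤ)) :=
    primrecPred_isCoveringAt.comp (f := fun p : ℕ × ℕ × Input × ℕ =>
        (p.2.2.1, p.2.2.2.unpair, ((p.2.1 : ℤ), (p.1 : ℤ)))) <|
      Primrec.pair (Primrec.fst.comp (Primrec.snd.comp Primrec.snd)) <|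
        Primrec.pair (Primrec.unpair.comp (Primrec.snd.comp (Primrec.snd.comp Primrec.snd))) <|
          Primrec.pair (primrec_natCast_int.comp (Primrec.fst.comp Primrec.snd))
            (primrec_natCast_int.comp Primrec.fst)
  have hinner : PrimrecRel fun (i : ℕ) (q : Input × ℕ) => ∀ j ∈ List.range q.2.unpair.1,
      IsCoveringAt q.1.1.toFinset q.1.2.1 q.1.2.2
        (coloring q.2.unpair.1 q.2.unpair.2) ((i : ℤ), (j : ℤ)) :=
    hcore.forall_mem_list.comp (Primrec.list_range.comp (hK.comp Primrec.snd)) Primrec.id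
  exact (nat_lt.comp (Primrec.const 0) hK).and
    (hinner.forall_mem_list.comp (Primrec.list_range.comp hK) Primrec.id)

lemma primrecRel_obstructionCertificate : PrimrecRel ObstructionCertificate := by
  have hpt : Primrec (Denumerable.ofNat (ℤ × ℤ)) := Primrec.ofNat _
  have hnb : PrimrecRel fun (d : ℤ × ℤ) (q : ℕ × ℕ × Input × ℕ) =>
      encode (Denumerable.ofNat (ℤ × ℤ) q.1 + d) < q.2.2.2 :=
    nat_lt.comp (Primrec.encode.comp (primrec_add_point.comp
      (hpt.comp (Primrec.fst.comp Primrec.snd)) Primrec.fst))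
      (Primrec.snd.comp (Primrec.snd.comp (Primrec.snd.comp Primrec.snd)))
  have hnbr : PrimrecRel fun (i : ℕ) (q : ℕ × Input × ℕ) =>
      ∀ d ∈ q.2.1.1, encode (Denumerable.ofNat (ℤ × ℤ) i + d) < q.2.2 :=
    hnb.forall_mem_list.comp
      (Primrec.fst.comp (Primrec.fst.comp (Primrec.snd.comp Primrec.snd))) Primrec.id
  have hviol : PrimrecRel fun (i : ℕ) (q : ℕ × Input × ℕ) =>
      ¬ IsCoveringAt q.2.1.1.toFinset q.2.1.2.1 q.2.1.2.2 (coloring 0 q.1)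
        (Denumerable.ofNat (ℤ × ℤ) i) :=
    (primrecPred_isCoveringAt.comp (f := fun p : ℕ × ℕ × Input × ℕ =>
        (p.2.2.1, (0, p.2.1), Denumerable.ofNat (ℤ × ℤ) p.1)) <|
      Primrec.pair (Primrec.fst.comp (Primrec.snd.comp Primrec.snd)) <|
        Primrec.pair (Primrec.pair (Primrec.const 0) (Primrec.fst.comp Primrec.snd))
          (hpt.comp Primrec.fst)).not
  have hboth : PrimrecRel fun (i : ℕ) (q : ℕ × Input × ℕ) =>
      (∀ d ∈ q.2.1.1, encode (Denumerable.ofNat (ℤ × ℤ) i + d) < q.2.2) ∧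
        ¬ IsCoveringAt q.2.1.1.toFinset q.2.1.2.1 q.2.1.2.2 (coloring 0 q.1)
          (Denumerable.ofNat (ℤ × ℤ) i) :=
    PrimrecPred.and hnbr hviol
  have hex : PrimrecRel fun (t : ℕ) (q : Input × ℕ) => ∃ i ∈ List.range q.2,
      (∀ d ∈ q.1.1, encode (Denumerable.ofNat (ℤ × ℤ) i + d) < q.2) ∧
        ¬ IsCoveringAt q.1.1.toFinset q.1.2.1 q.1.2.2 (coloring 0 t)
          (Denumerable.ofNat (ℤ × ℤ) i) :=
    hboth.exists_mem_list.comp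
      (Primrec.list_range.comp (Primrec.snd.comp Primrec.snd)) Primrec.id
  exact hex.forall_mem_list.comp (Primrec.list_range.comp
    (primrec_nat_pow.comp (Primrec.const 2) Primrec.snd)) Primrec.id

/-- Every configuration agrees on finitely many cells with one coded by a number. -/
lemma exists_testBit_eq (c : ℤ × ℤ → Fin 2) (n : ℕ) : ∃ t < 2 ^ n, ∀ u : ℤ × ℤ, encode u < n →
    (if t.testBit (encode u) then (1 : Fin 2) else 0) = c u := by
  refine ⟨Nat.ofBits fun i : Fin n => decide (c (Denumerable.ofNat (ℤ × ℤ) i) = 1),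
    Nat.ofBits_lt_two_pow _, fun u hu => ?_⟩
  rw [Nat.testBit_ofBits_lt _ _ hu]
  simp only [Denumerable.ofNat_encode, decide_eq_true_eq]
  split_ifs with h
  · exact h.symm
  · by_contra h0
    exact h (Fin.eq_one_of_ne_zero _ (Ne.symm h0))

lemma PeriodicCertificate.exists_isCovering {x : Input} {n : ℕ} (h : PeriodicCertificate x n) :
    ∃ c, IsCovering x.1.toFinset x.2.1 x.2.2 c := by
  obtain ⟨hK, h⟩ := h
  set K := n.unpair.1 with hKdef
  set t := n.unpair.2
  have hK' : (K : ℤ) ≠ 0 := by omega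
  refine ⟨coloring K t, isCovering_iff.2 fun u => ?_⟩
  have hpos : ∀ z : ℤ, 0 ≤ z % K := fun z => Int.emod_nonneg z hK'
  have hlt : ∀ z : ℤ, z % K < K := fun z => Int.emod_lt_of_pos z (by omega)
  have h1 := h (u.1 % K).toNat (by have := hpos u.1; have := hlt u.1; simp; omega)
    (u.2 % K).toNat (by have := hpos u.2; have := hlt u.2; simp; omega)
  rw [Int.toNat_of_nonneg (hpos _), Int.toNat_of_nonneg (hpos _)] at h1
  exact h1.congr (coloring_congr t (by simp) (by simp)) fun d _ =>
    coloring_congr t (by simp) (by simp)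

lemma exists_periodicCertificate {x : Input} {K : ℕ} (hK : 0 < K) {c : ℤ × ℤ → Fin 2}
    (hc : IsCovering x.1.toFinset x.2.1 x.2.2 c)
    (hper : ∀ (u : ℤ × ℤ) (y z : ℤ), c (u + (y * K, z * K)) = c u) :
    ∃ n, PeriodicCertificate x n := by
  have hK' : (K : ℤ) ≠ 0 := by omega
  have hpos : ∀ z : ℤ, 0 ≤ z % K := fun z => Int.emod_nonneg z hK'
  have hlt : ∀ z : ℤ, z % K < K := fun z => Int.emod_lt_of_pos z (by omega)
  obtain ⟨m, hm⟩ : ∃ m : ℕ, ∀ u : ℤ × ℤ, encode (u.1 % (K : ℤ), u.2 % (K : ℤ)) < m := by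
    refine ⟨(Finset.Ico (0 : ℤ) K ×ˢ Finset.Ico (0 : ℤ) K).sup encode + 1, fun u => ?_⟩
    refine Nat.lt_succ_of_le (Finset.le_sup (f := encode) ?_)
    simp [hpos, hlt]
  obtain ⟨t, -, ht⟩ := exists_testBit_eq c m
  have hcol : ∀ u, coloring K t u = c u := by
    intro u
    rw [coloring, ht _ (hm u), ← hper _ (u.1 / K) (u.2 / K)]
    congr 1
    ext <;> simp [Int.emod_add_ediv_mul]
  refine ⟨Nat.pair K t, ?_⟩
  rw [PeriodicCertificate, Nat.unpair_pair]
  exact ⟨hK, fun i _ j _ => (isCovering_iff.1 hc _).congr (hcol _).symm fun d _ => (hcol _).symm⟩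

lemma coloring_zero (t : ℕ) (u : ℤ × ℤ) :
    coloring 0 t u = if t.testBit (encode u) then 1 else 0 := by
  simp [coloring]

lemma ObstructionCertificate.not_exists_isCovering {x : Input} {n : ℕ}
    (h : ObstructionCertificate x n) : ¬ ∃ c, IsCovering x.1.toFinset x.2.1 x.2.2 c := by
  rintro ⟨c, hc⟩
  obtain ⟨t, ht, htc⟩ := exists_testBit_eq c n
  obtain ⟨i, hi, hnb, hviol⟩ := h t (List.mem_range.2 ht)
  refine hviol ((isCovering_iff.1 hc (Denumerable.ofNat (ℤ × ℤ) i)).congr ?_ fun d hd => ?_)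
  · rw [coloring_zero, htc _ (by rwa [Denumerable.encode_ofNat, ← List.mem_range])]
  · rw [coloring_zero, htc _ (hnb d (List.mem_toFinset.1 hd))]

/-- If no finite obstruction exists, the partial coverings have a limit point by compactness of
the space of configurations, and that limit point is a covering. -/
lemma exists_obstructionCertificate {x : Input}
    (h : ¬ ∃ c, IsCovering x.1.toFinset x.2.1 x.2.2 c) : ∃ n, ObstructionCertificate x n := by
  by_contra! hcon
  unfold ObstructionCertificate at hcon
  push Not at hcon
  choose t _ ht using hcon
  obtain ⟨c, hc⟩ := exists_clusterPt_of_compactSpace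
    (Filter.map (fun n => coloring 0 (t n)) Filter.atTop)
  refine h ⟨c, isCovering_iff.2 fun u => ?_⟩
  -- the configurations that agree with the limit on the neighbourhood of `u`
  have hopen : ∀ᶠ c' in nhds c, c' u = c u ∧ ∀ d ∈ x.1.toFinset, c' (u + d) = c (u + d) := by
    have hval : ∀ v : ℤ × ℤ, ∀ᶠ c' in nhds c, c' v = c v := fun v =>
      (continuous_apply v).continuousAt.eventually
        ((isOpen_discrete {c v}).eventually_mem rfl)
    exact (hval u).and ((Filter.eventually_all_finset _).2 fun d _ => hval (u + d))
  have hfreq := MapClusterPt.frequently hc hopen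
  obtain ⟨n, hn, hagree, hagreeD⟩ := Filter.frequently_atTop.1 hfreq
    (max (encode u + 1) (x.1.toFinset.sup (fun d => encode (u + d)) + 1))
  have h1 : encode u < n := by omega
  have h2 : ∀ d ∈ x.1, encode (u + d) < n := by
    intro d hd
    have : encode (u + d) ≤ x.1.toFinset.sup fun d => encode (u + d) :=
      Finset.le_sup (f := fun d => encode (u + d)) (List.mem_toFinset.2 hd)
    omega
  have h3 := ht n (encode u) (List.mem_range.2 h1) (by simpa only [Denumerable.ofNat_encode] using h2)
  rw [Denumerable.ofNat_encode] at h3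
  exact h3.congr hagree hagreeD

end Search

end GridCovering

/-- The input is a triple `(l, b, a)`, where the finite shape is `D = l.toFinset`, presented by a
list `l` of its points (in any order, repetitions allowed). -/
theorem mainTheorem8 :
    DecidableOn
      (fun x : List (ℤ × ℤ) × ℕ × ℕ =>
        LineFactorsInAtMostOneDirection (coveringPoly x.1.toFinset x.2.1 x.2.2))
      (fun x : List (ℤ × ℤ) × ℕ × ℕ =>
        ∃ c : ℤ × ℤ → Fin 2, IsCovering x.1.toFinset x.2.1 x.2.2 c) := by
  refine GridCovering.decidableOn_of_certificates GridCovering.primrecRel_periodicCertificate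
    GridCovering.primrecRel_obstructionCertificate (fun x n h => h.exists_isCovering)
    (fun x n h => h.not_exists_isCovering) fun x hx => ?_
  by_cases h : ∃ c : ℤ × ℤ → Fin 2, IsCovering x.1.toFinset x.2.1 x.2.2 c
  · obtain ⟨c, hc⟩ := h
    obtain ⟨w, e, hdet, N, hN, hper⟩ := GridCovering.exists_period_of_isCovering hc hx
    obtain ⟨K, c', hK, hc', hper'⟩ := GridCovering.exists_doubly_periodic hc hdet hN hper
    exact (GridCovering.exists_periodicCertificate hK hc' hper').imp fun _ => Or.inl
  · exact (GridCovering.exists_obstructionCertificate h).imp fun _ => Or.inr
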